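/- Let $P_0$ be a probability measure on $\mathbb{R}^m$ and $T>0$. Let $\varphi_t:\mathbb{R}^m\to\mathbb{R}^m$, $0\le t<T$, be a continuous denoising autoencoder trained for $P_0$. That is: each $\varphi_t$ is measurable, the pushforward measure $\varphi_{t\sharp}P_0$ has a positive differentiable density $p_t$ with respect to Lebesgue measure, the score field $(t,x)\mapsto\nabla\log p_t(x)$ is continuous on $[0,T)\times\mathbb{R}^m$, and $\varphi$ is the flow of this field: $$\varphi_0(x)=x,\qquad \partial_t\varphi_t(x)=\nabla\log p_t(\varphi_t(x))\qquad (0\le t<T,\ x\in\mathbb{R}^m).$$ By a classical solution of an equation $\partial_t u_t=\pm\triangle u_t$ on $I\times\mathbb{R}^m$, where $I$ is an interval, we mean a function $u$ such that $u_t$ is $C^2$ for each $t\in I$, both $u$ and $\triangle u$ are continuous on $I\times\mathbb{R}^m$, and the equation holds at every point (with one-sided time derivatives at end points belonging to $I$). Then $p_t$ is a classical solution on $[0,T)\times\mathbb{R}^m$ of the backward heat equation $$\partial_t p_t=-\triangle p_t,$$ and its initial value is the data distribution: $p_{t=0}$ is a density of $P_0$. Moreover, for every $\tau\in(0,T)$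 this is equivalent to a final value problem for the ordinary heat equation, in the following sense. (a) A function $q$ is a classical solution of $\partial_t q_t=-\triangle q_t$ on $[0,\tau]\times\mathbb{R}^m$ such that $q_0$ is a density of $P_0$ if and only if $u_t:=q_{\tau-t}$ is a classical solution of $\partial_t u_t=\triangle u_t$ on $[0,\tau]\times\mathbb{R}^m$ such that $u_{\tau}$ is a density of $P_0$. (b) If $u_t$, $0\le t\le\tau$, are probability densities, then $u$ is a classical solution of the final value problem $\partial_t u_t=\triangle u_t$ on $[0,\tau]\times\mathbb{R}^m$ with $u_\tau$ a density of $P_0$ if and only if $p_t=u_{\tau-t}$ for all $0\le t\le\tau$. -/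

import Mathlib

open MeasureTheory Set

noncomputable section

/-- `f` is a probability density on `ℝᵐ`. -/
def IsProbabilityDensity {m : ℕ} (f : EuclideanSpace ℝ (Fin m) → ℝ) : Prop :=
  (∀ x, 0 ≤ f x) ∧ Integrable f volume ∧ ∫ x, f x = 1

/-- `f` is a density of the measure `P` on `ℝᵐ`. -/
def IsDensityOf {m : ℕ} (f : EuclideanSpace ℝ (Fin m) → ℝ)
    (P : Measure (EuclideanSpace ℝ (Fin m))) : Prop :=
  (∀ x, 0 ≤ f x) ∧ P = volume.withDensity (fun x => ENNReal.ofReal (f x))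

/-- The score `∇ log f` of a density `f`. -/
def score {m : ℕ} (f : EuclideanSpace ℝ (Fin m) → ℝ) (x : EuclideanSpace ℝ (Fin m)) :
    EuclideanSpace ℝ (Fin m) :=
  gradient (fun y => Real.log (f y)) x

/-- `φ` is a continuous denoising autoencoder trained for the data distribution `P₀`, on the
time interval `[0, T)`, and `p t` is the density of the pushforward of `P₀` under `φ t`.
The pushforwards have positive densities whose scores exist and form a continuous
time-dependent velocity field, and `φ` is the flow (solution operator) of this field. -/
structure IsContinuousDAE {m : ℕ} (T : ℝ) (P₀ : Measure (EuclideanSpace ℝ (Fin m)))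
    (φ : ℝ → EuclideanSpace ℝ (Fin m) → EuclideanSpace ℝ (Fin m))
    (p : ℝ → EuclideanSpace ℝ (Fin m) → ℝ) : Prop where
  measurable : ∀ t ∈ Ico 0 T, Measurable (φ t)
  pushforward : ∀ t ∈ Ico 0 T, IsDensityOf (p t) (P₀.map (φ t))
  pos : ∀ t ∈ Ico 0 T, ∀ x, 0 < p t x
  differentiable : ∀ t ∈ Ico 0 T, Differentiable ℝ (p t)
  continuousOn_score : ContinuousOn
    (fun z : ℝ × EuclideanSpace ℝ (Fin m) => score (p z.1) z.2) (Ico 0 T ×ˢ univ)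
  initial : ∀ x, φ 0 x = x
  flow : ∀ x, ∀ t ∈ Ico 0 T,
    HasDerivWithinAt (fun s => φ s x) (score (p t) (φ t x)) (Ico 0 T) t

/-- `u` is a classical solution on `I × ℝᵐ` of `∂ₜ u = c Δ u`: twice continuously differentiable in
space, with `u` and `Δ u` jointly continuous (one-sided time derivatives at end points of `I`). -/
structure SolvesDiffusion {m : ℕ} (c : ℝ) (I : Set ℝ)
    (u : ℝ → EuclideanSpace ℝ (Fin m) → ℝ) : Prop where
  contDiff : ∀ t ∈ I, ContDiff ℝ 2 (u t)
  continuousOn : ContinuousOn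
    (fun z : ℝ × EuclideanSpace ℝ (Fin m) => u z.1 z.2) (I ×ˢ univ)
  continuousOn_laplacian : ContinuousOn
    (fun z : ℝ × EuclideanSpace ℝ (Fin m) => Laplacian.laplacian (u z.1) z.2)
    (I ×ˢ univ)
  equation : ∀ t ∈ I, ∀ x,
    HasDerivWithinAt (fun s => u s x) (c * Laplacian.laplacian (u t) x) I t

/-- The heat equation `∂ₜ u = Δ u` on `I × ℝᵐ`. -/
def SolvesHeat {m : ℕ} (I : Set ℝ) (u : ℝ → EuclideanSpace ℝ (Fin m) → ℝ) : Prop :=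
  SolvesDiffusion 1 I u

/-- The backward heat equation `∂ₜ u = - Δ u` on `I × ℝᵐ`. -/
def SolvesBackwardHeat {m : ℕ} (I : Set ℝ) (u : ℝ → EuclideanSpace ℝ (Fin m) → ℝ) : Prop :=
  SolvesDiffusion (-1) I u

end

/-!
Integrating test functions along the flow and then by parts shows that `p` solves the backward heat
equation weakly. Plane waves, cut off at scale `1 / ε` with `ε → 0`, are admissible test functions
up to an error `O(ε)`, because `p` is bounded in `L¹`; hence the Fourier transform of `p s` is that
of `p t` multiplied by the Gaussian `exp (-4 * π ^ 2 * (t - s) * ‖w‖ ^ 2)` when `s < t`. By Fourier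
inversion, `p s` is the heat flow at time `t - s` issued from `p t`, which is smooth. The same
formula read from `s = 0` determines an `L¹`-bounded solution from its initial value.
-/

open scoped FourierTransform Laplacian Real RealInnerProductSpace Topology

section Laplacian

variable {E F ι : Type*} [NormedAddCommGroup E] [NormedAddCommGroup F] [NormedSpace ℝ F]

theorem contDiff_fderiv_apply_const [NormedSpace ℝ E] {f : E → F} {n k : WithTop ℕ∞}
    (hf : ContDiff ℝ n f) (hkn : k + 1 ≤ n) (v : E) : ContDiff ℝ k fun x => fderiv ℝ f x v :=
  (hf.fderiv_right hkn).clm_apply contDiff_const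

theorem continuous_fderiv_apply_const [NormedSpace ℝ E] {f : E → F} (hf : ContDiff ℝ 1 f) (v : E) :
    Continuous fun x => fderiv ℝ f x v :=
  (hf.continuous_fderiv one_ne_zero).clm_apply continuous_const

variable [InnerProductSpace ℝ E] [Fintype ι]

theorem fderiv_eq_sum_inner_smul (b : OrthonormalBasis ι ℝ E) (f : E → F) (x v : E) :
    fderiv ℝ f x v = ∑ i, ⟪b i, v⟫ • fderiv ℝ f x (b i) := by
  conv_lhs => rw [← b.sum_repr' v]
  simp only [map_sum, map_smul]

variable [FiniteDimensional ℝ E]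

theorem laplacian_eq_sum_fderiv_fderiv (b : OrthonormalBasis ι ℝ E) {f : E → F}
    (hf : ContDiff ℝ 2 f) (x : E) :
    Δ f x = ∑ i, fderiv ℝ (fun y => fderiv ℝ f y (b i)) x (b i) := by
  have hf' : DifferentiableAt ℝ (fderiv ℝ f) x :=
    (hf.fderiv_right (m := 1) le_rfl).differentiable one_ne_zero x
  rw [InnerProductSpace.laplacian_eq_iteratedFDeriv_orthonormalBasis f b]
  refine Finset.sum_congr rfl fun i _ => ?_
  rw [iteratedFDeriv_two_apply, fderiv_clm_apply hf' (by fun_prop)]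
  simp

theorem continuous_laplacian {f : E → F} (hf : ContDiff ℝ 2 f) : Continuous (Δ f) := by
  rw [funext (laplacian_eq_sum_fderiv_fderiv (stdOrthonormalBasis ℝ E) hf)]
  exact continuous_finsetSum _ fun i _ =>
    continuous_fderiv_apply_const (contDiff_fderiv_apply_const hf le_rfl _) _

theorem tsupport_laplacian_subset (f : E → F) : tsupport (Δ f) ⊆ tsupport f := by
  refine closure_minimal (fun x hx => ?_) (isClosed_tsupport f)
  contrapose! hx
  have h0 : f =ᶠ[𝓝 x] fun _ => 0 := notMem_tsupport_iff_eventuallyEq.mp hx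
  simpa using (InnerProductSpace.laplacian_congr_nhds h0).eq_of_nhds

theorem hasCompactSupport_laplacian {f : E → F} (hf : HasCompactSupport f) :
    HasCompactSupport (Δ f) :=
  hf.mono' ((subset_tsupport _).trans (tsupport_laplacian_subset f))

theorem laplacian_comp_const_smul {f : E → F} (hf : ContDiff ℝ 2 f) (c : ℝ) (x : E) :
    Δ (fun y => f (c • y)) x = c ^ 2 • Δ f (c • x) := by
  simp only [InnerProductSpace.laplacian_eq_iteratedFDeriv_orthonormalBasis _
    (stdOrthonormalBasis ℝ E), iteratedFDeriv_comp_const_smul c hf, Finset.smul_sum]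
  rfl

end Laplacian

section PlaneWave

variable {E : Type*} [NormedAddCommGroup E]

/-- The Fourier multiplier of the Laplacian. -/
noncomputable def laplacianSymbol (w : E) : ℝ := -(4 * π ^ 2 * ‖w‖ ^ 2)

variable [InnerProductSpace ℝ E]

/-- The plane wave `x ↦ exp (2πi ⟪x, w⟫)`, which is the integral kernel of `𝓕⁻`. -/
noncomputable def planeWave (w x : E) : ℂ := 𝐞 ⟪x, w⟫

theorem norm_planeWave (w x : E) : ‖planeWave w x‖ = 1 :=
  Circle.norm_coe _

theorem hasFDerivAt_planeWave (w x : E) :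
    HasFDerivAt (planeWave w) ((innerSL ℝ w).smulRight (2 * π * Complex.I * planeWave w x)) x := by
  have h : HasFDerivAt (fun y : E => ⟪y, w⟫) (innerSL ℝ w) x := by
    simp only [real_inner_comm w]
    exact (innerSL ℝ w).hasFDerivAt
  refine ((Real.hasDerivAt_fourierChar ⟪x, w⟫).hasFDerivAt.comp x h).congr_fderiv ?_
  ext v
  simp [planeWave]

theorem contDiff_planeWave (w : E) {n : WithTop ℕ∞} : ContDiff ℝ n (planeWave w) := by
  have h : planeWave w = fun x : E => Complex.exp (↑(2 * π * ⟪x, w⟫) * Complex.I) :=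
    funext fun x => Real.fourierChar_apply _
  rw [h]
  have hreal : ContDiff ℝ n fun x : E => 2 * π * ⟪x, w⟫ :=
    contDiff_const.mul (contDiff_id.inner ℝ contDiff_const)
  exact ((Complex.ofRealCLM.contDiff.comp hreal).mul contDiff_const).cexp

theorem fderiv_mul_planeWave {f : E → ℂ} {x : E} (hf : DifferentiableAt ℝ f x) (w v : E) :
    fderiv ℝ (fun y => f y * planeWave w y) x v =
      (fderiv ℝ f x v + 2 * π * Complex.I * ⟪w, v⟫ * f x) * planeWave w x := by
  rw [(hf.hasFDerivAt.fun_mul (hasFDerivAt_planeWave w x)).fderiv]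
  simp only [add_apply, smul_apply, ContinuousLinearMap.smulRight_apply, coe_innerSL_apply,
    Complex.real_smul, smul_eq_mul]
  ring

variable [FiniteDimensional ℝ E]

theorem laplacian_mul_planeWave {f : E → ℂ} (hf : ContDiff ℝ 2 f) (w x : E) :
    Δ (fun y => f y * planeWave w y) x =
      (Δ f x + 4 * π * Complex.I * fderiv ℝ f x w + laplacianSymbol w * f x) *
        planeWave w x := by
  let b := stdOrthonormalBasis ℝ E
  have hf1 : Differentiable ℝ f := hf.differentiable two_ne_zero
  have hf2 (i) : DifferentiableAt ℝ (fun y => fderiv ℝ f y (b i)) x :=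
    (contDiff_fderiv_apply_const (k := 1) hf le_rfl _).differentiable one_ne_zero x
  have hfb (i) : fderiv ℝ (fun y => fderiv ℝ (fun y => f y * planeWave w y) y (b i)) x (b i) =
      (fderiv ℝ (fun y => fderiv ℝ f y (b i)) x (b i) +
        4 * π * Complex.I * (⟪b i, w⟫ • fderiv ℝ f x (b i)) +
        -(4 * π ^ 2 * ⟪b i, w⟫ ^ 2 : ℝ) * f x) * planeWave w x := by
    simp only [fderiv_mul_planeWave (hf1 _)]
    rw [fderiv_mul_planeWave ((hf2 i).fun_add ((hf1 x).const_mul _)),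
      fderiv_fun_add (hf2 i) ((hf1 x).const_mul _), fderiv_const_mul (hf1 x), real_inner_comm]
    simp only [add_apply, smul_apply, smul_eq_mul, Complex.real_smul]
    push_cast
    linear_combination 4 * π ^ 2 * (⟪b i, w⟫ : ℂ) ^ 2 * f x * planeWave w x * Complex.I_sq
  rw [laplacian_eq_sum_fderiv_fderiv b (hf.mul (contDiff_planeWave w)),
    laplacian_eq_sum_fderiv_fderiv b hf, fderiv_eq_sum_inner_smul b, laplacianSymbol,
    ← b.sum_sq_inner_right w, Finset.sum_congr rfl fun i _ => hfb i, ← Finset.sum_mul,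
    Finset.sum_add_distrib, Finset.sum_add_distrib, ← Finset.mul_sum, ← Finset.sum_mul]
  push_cast
  rw [Finset.sum_neg_distrib, Finset.mul_sum, Finset.mul_sum]

end PlaneWave

section Green

variable {E F : Type*} [NormedAddCommGroup E] [InnerProductSpace ℝ E] [FiniteDimensional ℝ E]
  [MeasurableSpace E] [BorelSpace E] [NormedAddCommGroup F] [NormedSpace ℝ F] {f : E → F}
  {g : E → ℝ}

theorem integral_smul_fderiv_eq_neg_of_hasCompactSupport (hg : ContDiff ℝ 1 g)
    (hf : ContDiff ℝ 1 f) (hfc : HasCompactSupport f) (v : E) :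
    ∫ x, g x • fderiv ℝ f x v = -∫ x, fderiv ℝ g x v • f x := by
  have hf' := continuous_fderiv_apply_const hf v
  have hg' := continuous_fderiv_apply_const hg v
  refine integral_smul_fderiv_eq_neg_fderiv_smul_of_integrable ?_ ?_ ?_
    (fun x _ => hg.differentiable one_ne_zero x) (fun x _ => hf.differentiable one_ne_zero x)
  · exact (hg'.smul hf.continuous).integrable_of_hasCompactSupport hfc.smul_left
  · exact (hg.continuous.smul hf').integrable_of_hasCompactSupport
      (hfc.fderiv_apply (𝕜 := ℝ) v).smul_left
  · exact (hg.continuous.smul hf.continuous).integrable_of_hasCompactSupport hfc.smul_left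

theorem integral_smul_laplacian_eq_neg_sum {ι : Type*} [Fintype ι] (b : OrthonormalBasis ι ℝ E)
    (hg : ContDiff ℝ 1 g) (hf : ContDiff ℝ 2 f) (hfc : HasCompactSupport f) :
    ∫ x, g x • Δ f x = -∑ i, ∫ x, fderiv ℝ g x (b i) • fderiv ℝ f x (b i) := by
  have hf' (i) := contDiff_fderiv_apply_const (k := 1) hf le_rfl (b i)
  have hfc' (i) := hfc.fderiv_apply (𝕜 := ℝ) (b i)
  simp only [laplacian_eq_sum_fderiv_fderiv b hf, Finset.smul_sum]
  rw [integral_finsetSum, ← Finset.sum_neg_distrib]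
  · exact Finset.sum_congr rfl fun i _ =>
      integral_smul_fderiv_eq_neg_of_hasCompactSupport hg (hf' i) (hfc' i) (b i)
  · exact fun i _ => (hg.continuous.smul
      (continuous_fderiv_apply_const (hf' i) _)).integrable_of_hasCompactSupport
      ((hfc' i).fderiv_apply (𝕜 := ℝ) _).smul_left

theorem integral_smul_laplacian_eq_neg_integral_fderiv_gradient (hg : ContDiff ℝ 1 g)
    (hf : ContDiff ℝ 2 f) (hfc : HasCompactSupport f) :
    ∫ x, g x • Δ f x = -∫ x, fderiv ℝ f x (gradient g x) := by
  let b := stdOrthonormalBasis ℝ E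
  have hsum (x) : fderiv ℝ f x (gradient g x) =
      ∑ i, fderiv ℝ g x (b i) • fderiv ℝ f x (b i) := by
    rw [fderiv_eq_sum_inner_smul b]
    refine Finset.sum_congr rfl fun i _ => ?_
    rw [real_inner_comm, inner_gradient_left]
  rw [integral_smul_laplacian_eq_neg_sum b hg hf hfc]
  simp only [hsum]
  rw [integral_finsetSum]
  exact fun i _ => ((continuous_fderiv_apply_const hg _).smul (continuous_fderiv_apply_const
    (hf.of_le one_le_two) _)).integrable_of_hasCompactSupport
    (hfc.fderiv_apply (𝕜 := ℝ) _).smul_left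

theorem integral_smul_laplacian_eq_integral_laplacian_smul (hg : ContDiff ℝ 2 g)
    (hf : ContDiff ℝ 2 f) (hfc : HasCompactSupport f) :
    ∫ x, g x • Δ f x = ∫ x, Δ g x • f x := by
  let b := stdOrthonormalBasis ℝ E
  have hg' (i) := contDiff_fderiv_apply_const (k := 1) hg le_rfl (b i)
  rw [integral_smul_laplacian_eq_neg_sum b (hg.of_le one_le_two) hf hfc]
  simp only [laplacian_eq_sum_fderiv_fderiv b hg, Finset.sum_smul]
  rw [integral_finsetSum, ← Finset.sum_neg_distrib]
  · refine Finset.sum_congr rfl fun i _ => neg_eq_iff_eq_neg.mpr ?_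
    exact integral_smul_fderiv_eq_neg_of_hasCompactSupport (hg' i) (hf.of_le one_le_two) hfc (b i)
  · exact fun i _ => ((continuous_fderiv_apply_const (hg' i) _).smul
      hf.continuous).integrable_of_hasCompactSupport hfc.smul_left

end Green

section Cutoff

variable {E : Type*} [NormedAddCommGroup E] [InnerProductSpace ℝ E] [FiniteDimensional ℝ E]
  {χ : E → ℂ}

theorem exists_norm_laplacian_cutoff_mul_planeWave_sub_le (hχ : ContDiff ℝ 2 χ)
    (hχc : HasCompactSupport χ) (w : E) :
    ∃ C, ∀ ε ∈ Ioc (0 : ℝ) 1, ∀ x, ‖Δ (fun y => χ (ε • y) * planeWave w y) x -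
      laplacianSymbol w * (χ (ε • x) * planeWave w x)‖ ≤ C * ε := by
  obtain ⟨K, hK⟩ := (continuous_fderiv_apply_const (hχ.of_le one_le_two)
    w).bounded_above_of_compact_support (hχc.fderiv_apply (𝕜 := ℝ) w)
  obtain ⟨M, hM⟩ := (continuous_laplacian hχ).bounded_above_of_compact_support
    (hasCompactSupport_laplacian hχc)
  refine ⟨M + 4 * π * K, fun ε ⟨hε, hε1⟩ x => ?_⟩
  have : 0 ≤ M := (norm_nonneg _).trans (hM 0)
  have hfderiv : fderiv ℝ (fun y => χ (ε • y)) x w = ε * fderiv ℝ χ (ε • x) w := by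
    rw [fderiv_comp_smul]
    simp
  have herror : Δ (fun y => χ (ε • y) * planeWave w y) x -
      laplacianSymbol w * (χ (ε • x) * planeWave w x) =
      (ε ^ 2 * Δ χ (ε • x) + 4 * π * Complex.I * (ε * fderiv ℝ χ (ε • x) w)) *
        planeWave w x := by
    rw [laplacian_mul_planeWave (f := fun y => χ (ε • y)) (by fun_prop),
      laplacian_comp_const_smul hχ, hfderiv, Complex.real_smul]
    push_cast
    ring
  rw [herror, norm_mul, norm_planeWave, mul_one]
  calc ‖(ε ^ 2 * Δ χ (ε • x) + 4 * π * Complex.I * (ε * fderiv ℝ χ (ε • x) w) : ℂ)‖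
      ≤ ε ^ 2 * ‖Δ χ (ε • x)‖ + 4 * π * (ε * ‖fderiv ℝ χ (ε • x) w‖) := by
        refine (norm_add_le _ _).trans_eq ?_
        simp [abs_of_pos hε, abs_of_pos Real.pi_pos]
    _ ≤ ε * M + 4 * π * (ε * K) := by
        gcongr
        · exact pow_le_of_le_one hε.le hε1 two_ne_zero
        · exact hM _
        · exact hK _
    _ = (M + 4 * π * K) * ε := by ring

theorem tendsto_integral_smul_cutoff_mul_planeWave [MeasurableSpace E] [BorelSpace E]
    {f : E → ℝ} (hf : Integrable f) (hχ : Continuous χ) (hχ0 : χ 0 = 1)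
    {K : ℝ} (hχK : ∀ x, ‖χ x‖ ≤ K) (w : E) :
    Filter.Tendsto (fun ε : ℝ => ∫ x, f x • (χ (ε • x) * planeWave w x)) (𝓝[>] 0)
      (𝓝 (𝓕⁻ (fun x => (f x : ℂ)) w)) := by
  have hwave : Continuous (planeWave w) := (contDiff_planeWave w (n := 0)).continuous
  rw [Real.fourierInv_eq]
  refine tendsto_integral_filter_of_dominated_convergence (fun x => ‖f x‖ * K)
    (.of_forall fun ε => ?_) (.of_forall fun ε => .of_forall fun x => ?_) (hf.norm.mul_const K)
    (.of_forall fun x => ?_)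
  · exact hf.aestronglyMeasurable.smul (Continuous.aestronglyMeasurable (by fun_prop))
  · rw [norm_smul, norm_mul, norm_planeWave, mul_one]
    exact mul_le_mul_of_nonneg_left (hχK _) (norm_nonneg _)
  · have h : Continuous fun ε : ℝ => f x • (χ (ε • x) * planeWave w x) := by fun_prop
    refine ((h.tendsto 0).mono_left nhdsWithin_le_nhds).trans_eq ?_
    simp [hχ0, planeWave, Circle.smul_def, mul_comm]

end Cutoff

section ExponentialDecay

variable {F : Type*} [NormedAddCommGroup F] [NormedSpace ℝ F] {y y' : ℝ → F} {a b : ℝ}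

theorem norm_image_sub_le_of_norm_hasDerivAt_le {C : ℝ} (hab : a < b)
    (hy : ContinuousOn y (Icc a b)) (hy' : ∀ t ∈ Ioo a b, HasDerivAt y (y' t) t)
    (hC : ∀ t ∈ Ioo a b, ‖y' t‖ ≤ C) : ‖y b - y a‖ ≤ C * (b - a) := by
  have hC0 : 0 ≤ C :=
    (norm_nonneg _).trans (hC ((a + b) / 2) ⟨by linarith, by linarith⟩)
  lift C to NNReal using hC0
  have hlip : LipschitzOnWith C y (closure (Ioo a b)) := by
    rw [lipschitzOnWith_closure_iff (by rwa [closure_Ioo hab.ne])]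
    exact (convex_Ioo a b).lipschitzOnWith_of_nnnorm_hasDerivWithin_le
      (fun t ht => (hy' t ht).hasDerivWithinAt) hC
  rw [closure_Ioo hab.ne] at hlip
  simpa [abs_of_pos (sub_pos.mpr hab)] using
    hlip.norm_sub_le (right_mem_Icc.mpr hab.le) (left_mem_Icc.mpr hab.le)

theorem norm_sub_exp_smul_le_of_norm_deriv_sub_smul_le {k δ : ℝ} (hab : a < b)
    (hy : ContinuousOn y (Icc a b)) (hy' : ∀ t ∈ Ioo a b, HasDerivAt y (y' t) t)
    (hδ : ∀ t ∈ Ioo a b, ‖y' t - k • y t‖ ≤ δ) :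
    ‖y b - Real.exp (k * (b - a)) • y a‖ ≤ Real.exp (|k| * (b - a)) * δ * (b - a) := by
  have hderiv (t) (ht : t ∈ Ioo a b) : HasDerivAt (fun s => Real.exp (k * (b - s)) • y s)
      (Real.exp (k * (b - t)) • (y' t - k • y t)) t := by
    have hexp : HasDerivAt (fun s => Real.exp (k * (b - s)))
        (Real.exp (k * (b - t)) * (k * -1)) t :=
      (((hasDerivAt_id t).const_sub b).const_mul k).exp
    refine (hexp.smul (hy' t ht)).congr_deriv ?_
    module
  have hbound (t) (ht : t ∈ Ioo a b) : ‖Real.exp (k * (b - t)) • (y' t - k • y t)‖ ≤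
      Real.exp (|k| * (b - a)) * δ := by
    rw [norm_smul, Real.norm_of_nonneg (Real.exp_pos _).le]
    gcongr
    · exact sub_nonneg.mpr ht.2.le
    · exact le_abs_self k
    · exact ht.1.le
    · exact hδ t ht
  simpa using norm_image_sub_le_of_norm_hasDerivAt_le hab
    ((Continuous.continuousOn (by fun_prop)).smul hy) hderiv hbound

end ExponentialDecay

section FourierHeatFlow

variable {E : Type*} [NormedAddCommGroup E]

/-- The heat semigroup on the Fourier side. Negative times are allowed. -/
noncomputable def fourierHeatFlow (t : ℝ) (g : E → ℂ) (w : E) : ℂ :=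
  Real.exp (t * laplacianSymbol w) • g w

theorem fourierHeatFlow_zero (g : E → ℂ) : fourierHeatFlow 0 g = g := by
  ext w
  simp [fourierHeatFlow]

theorem fourierHeatFlow_fourierHeatFlow (s t : ℝ) (g : E → ℂ) :
    fourierHeatFlow s (fourierHeatFlow t g) = fourierHeatFlow (s + t) g := by
  ext w
  simp [fourierHeatFlow, add_mul, Real.exp_add, mul_assoc]

theorem norm_fourierHeatFlow (t : ℝ) (g : E → ℂ) (w : E) :
    ‖fourierHeatFlow t g w‖ = Real.exp (t * laplacianSymbol w) * ‖g w‖ := by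
  rw [fourierHeatFlow, norm_smul, Real.norm_of_nonneg (Real.exp_pos _).le]

theorem norm_fourierHeatFlow_anti {s t : ℝ} (hst : s ≤ t) (g : E → ℂ) (w : E) :
    ‖fourierHeatFlow t g w‖ ≤ ‖fourierHeatFlow s g w‖ := by
  rw [norm_fourierHeatFlow, norm_fourierHeatFlow]
  gcongr ?_ * _
  refine Real.exp_le_exp.mpr (mul_le_mul_of_nonpos_right hst ?_)
  exact neg_nonpos.mpr (by positivity)

theorem hasDerivAt_fourierHeatFlow (t : ℝ) (g : E → ℂ) (w : E) :
    HasDerivAt (fun t => fourierHeatFlow t g w)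
      (fourierHeatFlow t (fun w => laplacianSymbol w • g w) w) t := by
  have h : HasDerivAt (fun t => Real.exp (t * laplacianSymbol w))
      (Real.exp (t * laplacianSymbol w) * (1 * laplacianSymbol w)) t :=
    ((hasDerivAt_id t).mul_const _).exp
  simpa [fourierHeatFlow, mul_smul] using h.smul_const (g w)

theorem continuous_laplacianSymbol : Continuous (laplacianSymbol (E := E)) := by
  unfold laplacianSymbol
  fun_prop

end FourierHeatFlow

section FourierInversion

variable {E F : Type*} [NormedAddCommGroup E] [InnerProductSpace ℝ E] [FiniteDimensional ℝ E]
  [MeasurableSpace E] [BorelSpace E] [NormedAddCommGroup F] [NormedSpace ℂ F] {f g : E → F}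

theorem fourierInv_sub_of_integrable (hf : Integrable f) (hg : Integrable g) :
    𝓕⁻ (f - g) = 𝓕⁻ f - 𝓕⁻ g := by
  have hint {f : E → F} (hf : Integrable f) (w : E) : Integrable fun x => 𝐞 ⟪x, w⟫ • f x := by
    simpa using (Real.fourierIntegral_convergent_iff (-w)).mpr hf
  ext w
  simp only [Real.fourierInv_eq, Pi.sub_apply, smul_sub, integral_sub (hint hf w) (hint hg w)]

theorem eq_of_fourierInv_eq [CompleteSpace F] (hfc : Continuous f) (hgc : Continuous g)
    (hf : Integrable f) (hg : Integrable g) (h : 𝓕⁻ f = 𝓕⁻ g) : f = g := by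
  have hsub : 𝓕⁻ (f - g) = 0 := by rw [fourierInv_sub_of_integrable hf hg, h, sub_self]
  have hzero : 𝓕 (f - g) = 0 := by
    ext w
    simpa [hsub] using (Real.fourierInv_eq_fourier_neg (f - g) (-w)).symm
  have hinv := (hfc.sub hgc).fourierInv_fourier_eq (hf.sub hg) (by
    rw [hzero]
    exact integrable_zero _ _ _)
  rw [hzero] at hinv
  refine sub_eq_zero.mp (hinv.symm.trans (funext fun w => ?_))
  simp [Real.fourierInv_eq]

end FourierInversion

section WeakSolution

variable {E : Type*} [NormedAddCommGroup E] [InnerProductSpace ℝ E] [FiniteDimensional ℝ E]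
  [MeasurableSpace E] [BorelSpace E] {c a b : ℝ} {u v : ℝ → E → ℝ}

/-- `u` is an `L¹`-bounded weak solution of `∂ₜ u = c Δ u` on `[a, b]`, tested against functions of
space only. Test functions are complex-valued so that cut-off plane waves are admissible. -/
structure IsWeakSolution (c a b : ℝ) (u : ℝ → E → ℝ) : Prop where
  integrable : ∀ t ∈ Icc a b, Integrable (u t)
  bounded : ∃ M, ∀ t ∈ Icc a b, ∫ x, ‖u t x‖ ≤ M
  continuousOn : ∀ f : E → ℂ, ContDiff ℝ 2 f → HasCompactSupport f →
    ContinuousOn (fun t => ∫ x, u t x • f x) (Icc a b)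
  hasDerivAt : ∀ f : E → ℂ, ContDiff ℝ 2 f → HasCompactSupport f → ∀ t ∈ Ioo a b,
    HasDerivAt (fun s => ∫ x, u s x • f x) (c • ∫ x, u t x • Δ f x) t

theorem IsWeakSolution.mono (h : IsWeakSolution c a b u) {a' b' : ℝ} (ha : a ≤ a')
    (hb : b' ≤ b) : IsWeakSolution c a' b' u where
  integrable t ht := h.integrable t (Icc_subset_Icc ha hb ht)
  bounded := h.bounded.imp fun _ hM t ht => hM t (Icc_subset_Icc ha hb ht)
  continuousOn f hf hfc := (h.continuousOn f hf hfc).mono (Icc_subset_Icc ha hb)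
  hasDerivAt f hf hfc t ht := h.hasDerivAt f hf hfc t (Ioo_subset_Ioo ha hb ht)

theorem IsWeakSolution.norm_integral_sub_exp_smul_le (h : IsWeakSolution c a b u) (hab : a < b)
    {M : ℝ} (hM : ∀ t ∈ Icc a b, ∫ x, ‖u t x‖ ≤ M) {f : E → ℂ} (hf : ContDiff ℝ 2 f)
    (hfc : HasCompactSupport f) {k δ : ℝ} (hδ : ∀ x, ‖Δ f x - k * f x‖ ≤ δ) :
    ‖(∫ x, u b x • f x) - Real.exp (c * k * (b - a)) • ∫ x, u a x • f x‖ ≤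
      Real.exp (|c * k| * (b - a)) * (|c| * (M * δ)) * (b - a) := by
  refine norm_sub_exp_smul_le_of_norm_deriv_sub_smul_le hab (h.continuousOn f hf hfc)
    (h.hasDerivAt f hf hfc) fun t ht => ?_
  have ht' := Ioo_subset_Icc_self ht
  have hδ0 : 0 ≤ δ := (norm_nonneg _).trans (hδ 0)
  have hint (g : E → ℂ) (hg : Continuous g) (hgc : HasCompactSupport g) :
      Integrable fun x => u t x • g x := by
    obtain ⟨K, hK⟩ := hg.bounded_above_of_compact_support hgc
    exact (h.integrable t ht').smul_bdd K hg.aestronglyMeasurable (.of_forall hK)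
  have hdefect : c • (∫ x, u t x • Δ f x) - (c * k) • ∫ x, u t x • f x =
      c • ∫ x, u t x • (Δ f x - k * f x) := by
    rw [mul_smul, ← smul_sub, ← integral_smul k, ← integral_sub
      (hint _ (continuous_laplacian hf) (hasCompactSupport_laplacian hfc))
      ((hint f hf.continuous hfc).fun_smul k)]
    simp only [smul_sub, ← Complex.real_smul, smul_comm k]
  rw [hdefect, norm_smul, Real.norm_eq_abs]
  gcongr
  calc ‖∫ x, u t x • (Δ f x - k * f x)‖ ≤ ∫ x, ‖u t x‖ * δ := by
        refine norm_integral_le_of_norm_le ((h.integrable t ht').norm.mul_const δ)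
          (.of_forall fun x => ?_)
        rw [norm_smul]
        exact mul_le_mul_of_nonneg_left (hδ x) (norm_nonneg _)
    _ ≤ M * δ := by
        rw [integral_mul_const]
        exact mul_le_mul_of_nonneg_right (hM t ht') hδ0

theorem IsWeakSolution.fourierInv_eq (h : IsWeakSolution c a b u) (hab : a ≤ b) :
    𝓕⁻ (fun x => (u b x : ℂ)) = fourierHeatFlow (c * (b - a)) (𝓕⁻ fun x => (u a x : ℂ)) := by
  rcases hab.eq_or_lt with rfl | hab
  · simp [fourierHeatFlow_zero]
  funext w
  let χ : ContDiffBump (0 : E) := ⟨1, 2, one_pos, one_lt_two⟩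
  have hχ : ContDiff ℝ 2 fun x => (χ x : ℂ) := Complex.ofRealCLM.contDiff.comp χ.contDiff
  have hχc : HasCompactSupport fun x => (χ x : ℂ) :=
    χ.hasCompactSupport.comp_left Complex.ofReal_zero
  have hχ0 : (χ 0 : ℂ) = 1 := by
    rw [χ.one_of_mem_closedBall (by simp [χ]), Complex.ofReal_one]
  obtain ⟨K, hK⟩ := hχ.continuous.bounded_above_of_compact_support hχc
  obtain ⟨C, hC⟩ := exists_norm_laplacian_cutoff_mul_planeWave_sub_le hχ hχc w
  obtain ⟨M, hM⟩ := h.bounded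
  have hlim (t) (ht : t ∈ Icc a b) := tendsto_integral_smul_cutoff_mul_planeWave
    (h.integrable t ht) hχ.continuous hχ0 hK w
  have hdefect := ((hlim b (right_mem_Icc.mpr hab.le)).sub ((hlim a
    (left_mem_Icc.mpr hab.le)).const_smul (Real.exp (c * laplacianSymbol w * (b - a))))).norm
  let δ (ε : ℝ) := Real.exp (|c * laplacianSymbol w| * (b - a)) * (|c| * (M * (C * ε))) * (b - a)
  have hδ : Filter.Tendsto δ (𝓝[>] 0) (𝓝 0) := by
    have hδc : Continuous δ := by fun_prop
    simpa [δ] using (hδc.tendsto 0).mono_left (nhdsWithin_le_nhds (s := Ioi 0))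
  have hle := le_of_tendsto_of_tendsto hdefect hδ <| by
    filter_upwards [Ioc_mem_nhdsGT one_pos] with ε hε
    exact h.norm_integral_sub_exp_smul_le hab hM
      ((hχ.comp (contDiff_id.const_smul ε)).mul (contDiff_planeWave w))
      (hχc.comp_smul hε.1.ne').mul_right (hC ε hε)
  rw [fourierHeatFlow, mul_right_comm]
  exact sub_eq_zero.mp (norm_le_zero_iff.mp hle)

theorem IsWeakSolution.eq_of_eq (hu : IsWeakSolution c a b u) (hv : IsWeakSolution c a b v)
    (hab : a ≤ b) (huc : Continuous (u b)) (hvc : Continuous (v b)) (h : u a = v a) :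
    u b = v b := by
  have hb := right_mem_Icc.mpr hab
  have hF : 𝓕⁻ (fun x => (u b x : ℂ)) = 𝓕⁻ fun x => (v b x : ℂ) := by
    rw [hu.fourierInv_eq hab, hv.fourierInv_eq hab, h]
  have huv := eq_of_fourierInv_eq (Complex.continuous_ofReal.comp huc)
    (Complex.continuous_ofReal.comp hvc) (hu.integrable b hb).ofReal (hv.integrable b hb).ofReal hF
  exact funext fun x => Complex.ofReal_injective (congrFun huv x)

end WeakSolution

section GaussianIntegrable

variable {E : Type*} [NormedAddCommGroup E] [InnerProductSpace ℝ E] [FiniteDimensional ℝ E]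
  [MeasurableSpace E] [BorelSpace E] {g : E → ℂ}

/-- The heat flow makes `g` integrable in arbitrarily short positive time: the class of Fourier
data on which `𝓕 (fourierHeatFlow t g)` is a classical solution of the heat equation for `t > 0`. -/
def GaussianIntegrable (g : E → ℂ) : Prop := ∀ t > 0, Integrable (fourierHeatFlow t g)

theorem gaussianIntegrable_of_norm_le {B : ℝ} (hg : AEStronglyMeasurable g)
    (hB : ∀ w, ‖g w‖ ≤ B) : GaussianIntegrable g := fun t ht => by
  have hgauss : Integrable fun w : E => Real.exp (t * laplacianSymbol w) := by
    have h := (GaussianFourier.integrable_cexp_neg_mul_sq_norm_add (V := E)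
      (b := ((4 * π ^ 2 * t : ℝ) : ℂ)) (by rw [Complex.ofReal_re]; positivity) 0 0).norm
    refine h.congr (.of_forall fun w => ?_)
    have hexp : -((4 * π ^ 2 * t : ℝ) : ℂ) * (‖w‖ : ℂ) ^ 2 + 0 * ⟪0, w⟫ =
        ((t * laplacianSymbol w : ℝ) : ℂ) := by
      rw [laplacianSymbol]
      push_cast
      ring
    simp only [hexp, Complex.norm_exp, Complex.ofReal_re]
  exact hgauss.smul_bdd B hg (.of_forall hB)

theorem exists_pow_mul_exp_neg_mul_sq_le (n : ℕ) {k : ℝ} (hk : 0 < k) :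
    ∃ C, ∀ y : ℝ, 0 ≤ y → y ^ n * Real.exp (-(k * y ^ 2)) ≤ C := by
  refine ⟨n.factorial * Real.exp (1 / (4 * k)), fun y hy => ?_⟩
  have hpow : y ^ n ≤ n.factorial * Real.exp y := by
    rw [← div_le_iff₀' (by positivity)]
    exact Real.pow_div_factorial_le_exp y hy n
  have hsq : y - k * y ^ 2 ≤ 1 / (4 * k) := by
    rw [le_div_iff₀ (by positivity)]
    linarith [sq_nonneg (2 * k * y - 1)]
  calc y ^ n * Real.exp (-(k * y ^ 2))
      ≤ n.factorial * Real.exp y * Real.exp (-(k * y ^ 2)) := by gcongr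
    _ = n.factorial * Real.exp (y - k * y ^ 2) := by
        rw [mul_assoc, ← Real.exp_add, sub_eq_add_neg]
    _ ≤ n.factorial * Real.exp (1 / (4 * k)) := by gcongr

theorem GaussianIntegrable.aestronglyMeasurable (hg : GaussianIntegrable g) :
    AEStronglyMeasurable g := by
  have h : Continuous fun w : E => Real.exp (-1 * laplacianSymbol w) :=
    Real.continuous_exp.comp (continuous_laplacianSymbol.const_mul _)
  have hmeas := h.aestronglyMeasurable.smul (hg 1 one_pos).aestronglyMeasurable
  have heq : fourierHeatFlow (-1) (fourierHeatFlow 1 g) = g := by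
    rw [fourierHeatFlow_fourierHeatFlow, neg_add_cancel, fourierHeatFlow_zero]
  exact heq ▸ hmeas

theorem GaussianIntegrable.norm_pow_smul (hg : GaussianIntegrable g) (n : ℕ) :
    GaussianIntegrable fun w => ‖w‖ ^ n • g w := fun t ht => by
  obtain ⟨C, hC⟩ := exists_pow_mul_exp_neg_mul_sq_le n (k := 2 * π ^ 2 * t) (by positivity)
  have hmeas : AEStronglyMeasurable (fourierHeatFlow t fun w => ‖w‖ ^ n • g w) :=
    (Real.continuous_exp.comp (continuous_laplacianSymbol.const_mul _)).aestronglyMeasurable.smul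
      ((continuous_norm.pow n).aestronglyMeasurable.smul hg.aestronglyMeasurable)
  refine ((hg (t / 2) (half_pos ht)).norm.const_mul C).mono' hmeas (.of_forall fun w => ?_)
  have hexp : Real.exp (t * laplacianSymbol w) =
      Real.exp (-(2 * π ^ 2 * t * ‖w‖ ^ 2)) * Real.exp (t / 2 * laplacianSymbol w) := by
    rw [← Real.exp_add, laplacianSymbol]
    ring_nf
  calc ‖fourierHeatFlow t (fun w => ‖w‖ ^ n • g w) w‖
      = ‖w‖ ^ n * Real.exp (-(2 * π ^ 2 * t * ‖w‖ ^ 2)) * ‖fourierHeatFlow (t / 2) g w‖ := by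
        rw [norm_fourierHeatFlow, norm_fourierHeatFlow, norm_smul, norm_pow, norm_norm, hexp]
        ring
    _ ≤ C * ‖fourierHeatFlow (t / 2) g w‖ := by
        gcongr
        exact hC _ (norm_nonneg w)

theorem GaussianIntegrable.laplacianSymbol_smul (hg : GaussianIntegrable g) :
    GaussianIntegrable (fun w => laplacianSymbol w • g w) := fun t ht => by
  refine ((hg.norm_pow_smul 2 t ht).smul (-(4 * π ^ 2))).congr (.of_forall fun w => ?_)
  simp only [fourierHeatFlow, laplacianSymbol, Pi.smul_apply, smul_smul]
  ring_nf

end GaussianIntegrable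

section FourierHeatEquation

variable {E : Type*} [NormedAddCommGroup E] [InnerProductSpace ℝ E] [FiniteDimensional ℝ E]
  [MeasurableSpace E] [BorelSpace E] {f g : E → ℂ}

theorem GaussianIntegrable.continuousOn_fourier (hg : GaussianIntegrable g) :
    ContinuousOn (fun z : ℝ × E => 𝓕 (fourierHeatFlow z.1 g) z.2) (Ioi 0 ×ˢ univ) := by
  rintro ⟨t, x⟩ ⟨ht, -⟩
  obtain ⟨s, hs, hst⟩ := exists_between (show 0 < t from ht)
  have hnhds : ∀ᶠ z : ℝ × E in 𝓝 (t, x), s < z.1 :=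
    continuous_fst.continuousAt.eventually (Ioi_mem_nhds hst)
  simp only [Real.fourier_eq]
  refine (continuousAt_of_dominated (hnhds.mono fun z hz => ?_) (hnhds.mono fun z hz =>
    .of_forall fun w => ?_) (hg s hs).norm (.of_forall fun w => ?_)).continuousWithinAt
  · exact ((Real.fourierIntegral_convergent_iff z.2).mpr
      (hg z.1 (hs.trans hz))).aestronglyMeasurable
  · exact (Circle.norm_smul _ _).trans_le (norm_fourierHeatFlow_anti hz.le g w)
  · unfold fourierHeatFlow
    fun_prop

theorem GaussianIntegrable.hasDerivAt_fourier (hg : GaussianIntegrable g) {t : ℝ} (ht : 0 < t)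
    (x : E) : HasDerivAt (fun t => 𝓕 (fourierHeatFlow t g) x)
      (𝓕 (fourierHeatFlow t (fun w => laplacianSymbol w • g w)) x) t := by
  obtain ⟨s, hs, hst⟩ := exists_between ht
  have hint {g : E → ℂ} (hg : GaussianIntegrable g) {r : ℝ} (hr : s < r) :
      Integrable fun w => 𝐞 (-⟪w, x⟫) • fourierHeatFlow r g w :=
    (Real.fourierIntegral_convergent_iff x).mpr (hg r (hs.trans hr))
  have hg' := hg.laplacianSymbol_smul
  simp only [Real.fourier_eq]
  refine (hasDerivAt_integral_of_dominated_loc_of_deriv_le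
    (F' := fun r w => 𝐞 (-⟪w, x⟫) • fourierHeatFlow r (fun w => laplacianSymbol w • g w) w)
    (Ioi_mem_nhds hst)
    (Filter.mem_of_superset (Ioi_mem_nhds hst) fun r hr => (hint hg hr).aestronglyMeasurable)
    (hint hg hst) (hint hg' hst).aestronglyMeasurable (.of_forall fun w r hr => ?_)
    (hg' s hs).norm (.of_forall fun w r _ => ?_)).2
  · exact (Circle.norm_smul _ _).trans_le (norm_fourierHeatFlow_anti (mem_Ioi.mp hr).le _ w)
  · exact (hasDerivAt_fourierHeatFlow r g w).const_smul (𝐞 (-⟪w, x⟫))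

theorem laplacian_fourier_of_integrable (hf : ∀ n ≤ 2, Integrable fun w => ‖w‖ ^ n * ‖f w‖)
    (hfm : AEStronglyMeasurable f) : Δ (𝓕 f) = 𝓕 (fun w => laplacianSymbol w • f w) := by
  let b := stdOrthonormalBasis ℝ E
  have hint : Integrable fun w => VectorFourier.fourierPowSMulRight (innerSL ℝ) f w 2 :=
    VectorFourier.integrable_fourierPowSMulRight _ (hf 2 le_rfl) hfm
  have hsymbol (w) : ∑ i, VectorFourier.fourierPowSMulRight (innerSL ℝ) f w 2 ![b i, b i] =
      laplacianSymbol w • f w := by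
    rw [laplacianSymbol, ← b.sum_sq_inner_left, Finset.mul_sum, ← Finset.sum_neg_distrib,
      Finset.sum_smul]
    refine Finset.sum_congr rfl fun i _ => ?_
    simp only [VectorFourier.fourierPowSMulRight_apply, Fin.prod_univ_two, Matrix.cons_val_zero,
      Matrix.cons_val_one, Complex.real_smul, smul_eq_mul]
    rw [show innerSL ℝ w (b i) = ⟪w, b i⟫ from rfl]
    push_cast
    linear_combination 4 * π ^ 2 * (⟪w, b i⟫ : ℂ) ^ 2 * f w * Complex.I_sq
  ext x
  rw [InnerProductSpace.laplacian_eq_iteratedFDeriv_orthonormalBasis _ b,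
    Real.iteratedFDeriv_fourier (N := 2) (fun n hn => hf n (by exact_mod_cast hn)) hfm le_rfl]
  simp only [Real.fourier_continuousMultilinearMap_apply hint]
  simp only [Real.fourier_eq]
  rw [← integral_finsetSum]
  · simp only [← Finset.smul_sum, hsymbol]
  · exact fun i _ => (Real.fourierIntegral_convergent_iff x).mpr
      ((ContinuousMultilinearMap.apply ℝ (fun _ : Fin 2 => E) ℂ ![b i, b i]).integrable_comp hint)

theorem GaussianIntegrable.integrable_norm_pow_mul (hg : GaussianIntegrable g) {t : ℝ}
    (ht : 0 < t) (n : ℕ) : Integrable fun w => ‖w‖ ^ n * ‖fourierHeatFlow t g w‖ := by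
  refine (hg.norm_pow_smul n t ht).norm.congr (.of_forall fun w => ?_)
  simp only [norm_fourierHeatFlow, norm_smul, norm_pow, norm_norm]
  ring

theorem GaussianIntegrable.contDiff_fourier (hg : GaussianIntegrable g) {t : ℝ} (ht : 0 < t)
    {n : ℕ∞} : ContDiff ℝ n (𝓕 (fourierHeatFlow t g)) :=
  Real.contDiff_fourier fun k _ => hg.integrable_norm_pow_mul ht k

theorem GaussianIntegrable.laplacian_fourier (hg : GaussianIntegrable g) {t : ℝ} (ht : 0 < t) :
    Δ (𝓕 (fourierHeatFlow t g)) = 𝓕 (fourierHeatFlow t (fun w => laplacianSymbol w • g w)) := by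
  rw [laplacian_fourier_of_integrable (fun n _ => hg.integrable_norm_pow_mul ht n)
    (hg t ht).aestronglyMeasurable]
  congr 1
  ext w
  exact smul_comm (laplacianSymbol w) (Real.exp _) (g w)

theorem eq_re_fourier_fourierHeatFlow {u : E → ℝ} (hu : Integrable u) (huc : Continuous u)
    (hg : GaussianIntegrable g) {t : ℝ} (ht : 0 < t)
    (h : 𝓕⁻ (fun x => (u x : ℂ)) = fourierHeatFlow t g) (x : E) :
    u x = (𝓕 (fourierHeatFlow t g) x).re := by
  have hF : Integrable (𝓕 fun x => (u x : ℂ)) := by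
    refine (hg t ht).comp_neg.congr (.of_forall fun w => ?_)
    simp only [← h, Real.fourierInv_eq_fourier_neg, neg_neg]
  have hinv := (Complex.continuous_ofReal.comp huc).fourier_fourierInv_eq hu.ofReal hF
  rw [← h, ← Complex.ofReal_re (u x)]
  exact congrArg Complex.re (congrFun hinv x).symm

end FourierHeatEquation

theorem GaussianIntegrable.solvesHeat {m : ℕ} {g : EuclideanSpace ℝ (Fin m) → ℂ}
    (hg : GaussianIntegrable g) :
    SolvesHeat (Ioi 0) fun t x => (𝓕 (fourierHeatFlow t g) x).re := by
  have hΔ (t) (ht : 0 < t) (x) : Δ (fun x => (𝓕 (fourierHeatFlow t g) x).re) x =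
      (𝓕 (fourierHeatFlow t (fun w => laplacianSymbol w • g w)) x).re := by
    rw [← hg.laplacian_fourier ht]
    exact (hg.contDiff_fourier ht).contDiffAt.laplacian_CLM_comp_left (l := Complex.reCLM)
  refine ⟨fun t ht => Complex.reCLM.contDiff.comp (hg.contDiff_fourier ht),
    Complex.continuous_re.comp_continuousOn hg.continuousOn_fourier, ?_, fun t ht x => ?_⟩
  · exact (Complex.continuous_re.comp_continuousOn
      hg.laplacianSymbol_smul.continuousOn_fourier).congr fun z hz => hΔ z.1 hz.1 z.2
  · rw [one_mul, hΔ t ht]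
    exact (Complex.reCLM.hasFDerivAt.comp_hasDerivAt t
      (hg.hasDerivAt_fourier ht x)).hasDerivWithinAt

section Diffusion

variable {m : ℕ} {c : ℝ} {I J : Set ℝ} {u v : ℝ → EuclideanSpace ℝ (Fin m) → ℝ}

theorem SolvesDiffusion.mono (h : SolvesDiffusion c J u) (hIJ : I ⊆ J) :
    SolvesDiffusion c I u where
  contDiff t ht := h.contDiff t (hIJ ht)
  continuousOn := h.continuousOn.mono (prod_mono_left hIJ)
  continuousOn_laplacian := h.continuousOn_laplacian.mono (prod_mono_left hIJ)
  equation t ht x := (h.equation t (hIJ ht) x).mono hIJ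

theorem SolvesDiffusion.congr (h : SolvesDiffusion c I u) (huv : EqOn v u I) :
    SolvesDiffusion c I v where
  contDiff t ht := huv ht ▸ h.contDiff t ht
  continuousOn := h.continuousOn.congr fun z hz => congrFun (huv hz.1) z.2
  continuousOn_laplacian := h.continuousOn_laplacian.congr fun z hz => by
    simp only [huv hz.1]
  equation t ht x := by
    rw [huv ht]
    exact (h.equation t ht x).congr (fun s hs => congrFun (huv hs) x) (congrFun (huv ht) x)

theorem SolvesDiffusion.comp_const_sub (h : SolvesDiffusion c I u) {τ : ℝ}
    (hJ : MapsTo (fun t => τ - t) J I) : SolvesDiffusion (-c) J fun t => u (τ - t) := by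
  have hcomp {g : ℝ × EuclideanSpace ℝ (Fin m) → ℝ} (hg : ContinuousOn g (I ×ˢ univ)) :
      ContinuousOn (fun z => g (τ - z.1, z.2)) (J ×ˢ univ) :=
    hg.comp (Continuous.continuousOn (by fun_prop)) fun z hz => ⟨hJ hz.1, trivial⟩
  refine ⟨fun t ht => h.contDiff _ (hJ ht), hcomp h.continuousOn,
    hcomp h.continuousOn_laplacian, fun t ht x => ?_⟩
  have hsub : HasDerivWithinAt (fun t => τ - t) (-1) J t :=
    ((hasDerivAt_id t).const_sub τ).hasDerivWithinAt
  refine (HasDerivWithinAt.scomp (g₁ := fun s => u s x) t (h.equation _ (hJ ht) x) hsub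
    hJ).congr_deriv ?_
  rw [neg_one_smul, neg_mul]

theorem solvesDiffusion_of_forall_nhdsWithin
    (h : ∀ t ∈ I, ∃ J ∈ 𝓝[I] t, SolvesDiffusion c J u) : SolvesDiffusion c I u := by
  have hcont {g : ℝ × EuclideanSpace ℝ (Fin m) → ℝ}
      (hg : ∀ J, SolvesDiffusion c J u → ContinuousOn g (J ×ˢ univ)) :
      ContinuousOn g (I ×ˢ univ) := by
    rintro ⟨t, x⟩ ⟨ht, -⟩
    obtain ⟨J, hJI, hJ⟩ := h t ht
    refine (hg J hJ (t, x) ⟨mem_of_mem_nhdsWithin ht hJI, trivial⟩).mono_of_mem_nhdsWithin ?_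
    rw [nhdsWithin_prod_eq]
    exact Filter.prod_mem_prod hJI Filter.univ_mem
  refine ⟨fun t ht => ?_, hcont fun J hJ => hJ.continuousOn,
    hcont fun J hJ => hJ.continuousOn_laplacian, fun t ht x => ?_⟩ <;>
    obtain ⟨J, hJI, hJ⟩ := h t ht
  · exact hJ.contDiff t (mem_of_mem_nhdsWithin ht hJI)
  · exact (hJ.equation t (mem_of_mem_nhdsWithin ht hJI) x).mono_of_mem_nhdsWithin hJI

theorem solvesBackwardHeat_iff_solvesHeat_const_sub {τ : ℝ}
    (hI : MapsTo (fun t => τ - t) I I) :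
    SolvesBackwardHeat I u ↔ SolvesHeat I fun t => u (τ - t) := by
  refine ⟨fun h => ?_, fun h => ?_⟩
  · simpa [SolvesHeat] using SolvesDiffusion.comp_const_sub h hI
  · simpa [SolvesBackwardHeat] using SolvesDiffusion.comp_const_sub h hI

end Diffusion

section ClassicalIsWeak

theorem exists_integrable_bound_smul {X E F : Type*} [TopologicalSpace X]
    [TopologicalSpace E] [MeasurableSpace E] [OpensMeasurableSpace E] {μ : Measure E}
    [IsFiniteMeasureOnCompacts μ] [NormedAddCommGroup F] [NormedSpace ℝ F] {S : Set X}
    (hS : IsCompact S) {g : X × E → ℝ} (hg : ContinuousOn g (S ×ˢ univ)) {f : E → F}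
    (hf : Continuous f) (hfc : HasCompactSupport f) :
    ∃ K : E → ℝ, Integrable K μ ∧ ∀ t ∈ S, ∀ x, ‖g (t, x) • f x‖ ≤ K x := by
  obtain ⟨C, hC⟩ := (hS.prod hfc).exists_bound_of_continuousOn
    ((hg.smul (hf.comp continuous_snd).continuousOn).mono (prod_mono_right (subset_univ _)))
  refine ⟨(tsupport f).indicator fun _ => C, (integrable_indicator_iff
    (isClosed_tsupport f).measurableSet).mpr (integrableOn_const hfc.measure_lt_top.ne),
    fun t ht x => ?_⟩
  by_cases hx : x ∈ tsupport f
  · rw [indicator_of_mem hx]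
    exact hC (t, x) ⟨ht, hx⟩
  · rw [indicator_of_notMem hx, image_eq_zero_of_notMem_tsupport hx, smul_zero, norm_zero]

variable {m : ℕ} {c a b : ℝ} {u : ℝ → EuclideanSpace ℝ (Fin m) → ℝ}
  {f : EuclideanSpace ℝ (Fin m) → ℂ}

theorem SolvesDiffusion.hasDerivAt_integral_smul (h : SolvesDiffusion c (Icc a b) u)
    (hf : ContDiff ℝ 2 f) (hfc : HasCompactSupport f) {t : ℝ} (ht : t ∈ Ioo a b) :
    HasDerivAt (fun s => ∫ x, u s x • f x) (c • ∫ x, u t x • Δ f x) t := by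
  have hsub := Ioo_subset_Icc_self (a := a) (b := b)
  have hnhds : Ioo a b ∈ 𝓝 t := Ioo_mem_nhds ht.1 ht.2
  have huf (r) (hr : r ∈ Ioo a b) : Continuous fun x => u r x • f x :=
    (h.contDiff r (hsub hr)).continuous.smul hf.continuous
  have hΔ : Continuous (Δ (u t)) := continuous_laplacian (h.contDiff t (hsub ht))
  obtain ⟨K, hK, hle⟩ : ∃ K : EuclideanSpace ℝ (Fin m) → ℝ, Integrable K ∧
      ∀ r ∈ Icc a b, ∀ x, ‖(c * Δ (u r) x) • f x‖ ≤ K x :=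
    exists_integrable_bound_smul (g := fun z => c * Δ (u z.1) z.2) isCompact_Icc
      (continuousOn_const.mul h.continuousOn_laplacian) hf.continuous hfc
  have hderiv (x) (r) (hr : r ∈ Ioo a b) :
      HasDerivAt (fun s => u s x • f x) ((c * Δ (u r) x) • f x) r :=
    ((h.equation r (hsub hr) x).hasDerivAt (Icc_mem_nhds hr.1 hr.2)).smul_const (f x)
  have hmeas : ∀ᶠ r in 𝓝 t, AEStronglyMeasurable (fun x => u r x • f x) :=
    Filter.mem_of_superset hnhds fun r hr => (huf r hr).aestronglyMeasurable
  have hD := (hasDerivAt_integral_of_dominated_loc_of_deriv_le hnhds hmeas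
    ((huf t ht).integrable_of_hasCompactSupport (hfc.smul_left (f := u t)))
    ((hΔ.const_mul c).smul hf.continuous).aestronglyMeasurable
    (.of_forall fun x r hr => hle r (hsub hr) x) hK (.of_forall hderiv)).2
  refine hD.congr_deriv ?_
  simp only [mul_smul]
  rw [integral_smul, integral_smul_laplacian_eq_integral_laplacian_smul
    (h.contDiff t (hsub ht)) hf hfc]

theorem SolvesDiffusion.isWeakSolution (h : SolvesDiffusion c (Icc a b) u)
    (hint : ∀ t ∈ Icc a b, Integrable (u t)) (hbdd : ∃ M, ∀ t ∈ Icc a b, ∫ x, ‖u t x‖ ≤ M) :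
    IsWeakSolution c a b u where
  integrable := hint
  bounded := hbdd
  continuousOn f hf hfc := continuousOn_integral_of_compact_support hfc
    (h.continuousOn.smul (hf.continuous.comp continuous_snd).continuousOn)
    fun t x _ hx => by rw [image_eq_zero_of_notMem_tsupport hx, smul_zero]
  hasDerivAt f hf hfc _ ht := h.hasDerivAt_integral_smul hf hfc ht

end ClassicalIsWeak

theorem gaussianIntegrable_fourierInv {E : Type*} [NormedAddCommGroup E] [InnerProductSpace ℝ E]
    [FiniteDimensional ℝ E] [MeasurableSpace E] [BorelSpace E] {f : E → ℂ} (hf : Integrable f) :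
    GaussianIntegrable (𝓕⁻ f) := by
  have hcont : Continuous (𝓕⁻ f) := VectorFourier.fourierIntegral_continuous
    Real.continuous_fourierChar (L := -innerₗ E) continuous_inner.neg hf
  exact gaussianIntegrable_of_norm_le hcont.aestronglyMeasurable
    fun w => VectorFourier.norm_fourierIntegral_le_integral_norm _ _ _ f w

theorem IsWeakSolution.solvesBackwardHeat {m : ℕ} {a b : ℝ}
    {p : ℝ → EuclideanSpace ℝ (Fin m) → ℝ} (h : IsWeakSolution (-1) a b p)
    (hp : ∀ t ∈ Ico a b, Continuous (p t)) : SolvesBackwardHeat (Ico a b) p := by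
  rcases le_or_gt b a with hba | hab
  · rw [Ico_eq_empty hba.not_gt]
    exact ⟨by simp, by simp, by simp, by simp⟩
  let g := 𝓕⁻ fun x => (p b x : ℂ)
  have hg : GaussianIntegrable g :=
    gaussianIntegrable_fourierInv (h.integrable b (right_mem_Icc.mpr hab.le)).ofReal
  have hheat : SolvesDiffusion (-1) (Ico a b) fun t x => (𝓕 (fourierHeatFlow (b - t) g) x).re :=
    SolvesDiffusion.comp_const_sub hg.solvesHeat fun t ht => sub_pos.mpr ht.2
  refine hheat.congr fun t ht => funext fun x => ?_
  refine eq_re_fourier_fourierHeatFlow (h.integrable t (Ico_subset_Icc_self ht)) (hp t ht) hg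
    (sub_pos.mpr ht.2) ?_ x
  rw [show g = _ from (h.mono ht.1 le_rfl).fourierInv_eq ht.2.le, fourierHeatFlow_fourierHeatFlow,
    neg_one_mul, add_neg_cancel, fourierHeatFlow_zero]

section Density

variable {m : ℕ} {f g : EuclideanSpace ℝ (Fin m) → ℝ} {P : Measure (EuclideanSpace ℝ (Fin m))}

theorem IsDensityOf.integral_eq (h : IsDensityOf f P) (hf : AEMeasurable f) {F : Type*}
    [NormedAddCommGroup F] [NormedSpace ℝ F] (g : EuclideanSpace ℝ (Fin m) → F) :
    ∫ x, g x ∂P = ∫ x, f x • g x := by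
  rw [h.2, integral_withDensity_eq_integral_toReal_smul₀ hf.ennreal_ofReal
    (.of_forall fun _ => ENNReal.ofReal_lt_top)]
  simp only [ENNReal.toReal_ofReal (h.1 _)]

theorem IsDensityOf.integrable [IsFiniteMeasure P] (h : IsDensityOf f P) (hf : AEMeasurable f) :
    Integrable f := by
  refine ⟨hf.aestronglyMeasurable, ?_⟩
  rw [hasFiniteIntegral_iff_ofReal (.of_forall h.1), ← setLIntegral_univ,
    ← withDensity_apply _ MeasurableSet.univ, ← h.2]
  exact measure_lt_top _ _

theorem IsDensityOf.integral_norm (h : IsDensityOf f P) (hf : AEMeasurable f) :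
    ∫ x, ‖f x‖ = P.real univ := by
  simpa [Real.norm_of_nonneg (h.1 _)] using (h.integral_eq hf fun _ => (1 : ℝ)).symm

theorem IsDensityOf.eq_of_continuous (hf : IsDensityOf f P) (hg : IsDensityOf g P)
    (hfc : Continuous f) (hgc : Continuous g) : f = g := by
  have hae := (withDensity_eq_iff_of_sigmaFinite hfc.measurable.ennreal_ofReal.aemeasurable
    hgc.measurable.ennreal_ofReal.aemeasurable).mp (hf.2.symm.trans hg.2)
  refine (Continuous.ae_eq_iff_eq volume hfc hgc).mp (hae.mono fun x hx => ?_)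
  exact (ENNReal.ofReal_eq_ofReal_iff (hf.1 x) (hg.1 x)).mp hx

theorem gradient_eq_smul_score {x : EuclideanSpace ℝ (Fin m)} (hf : DifferentiableAt ℝ f x)
    (hx : f x ≠ 0) : gradient f x = f x • score f x := by
  rw [score, gradient, gradient, fderiv.log hf hx, map_smulₛₗ]
  simp [smul_smul, hx]

theorem contDiff_one_of_continuous_score (hf : Differentiable ℝ f) (hf0 : ∀ x, f x ≠ 0)
    (hs : Continuous (score f)) : ContDiff ℝ 1 f := by
  have hfderiv : fderiv ℝ f = fun x => InnerProductSpace.toDual ℝ _ (f x • score f x) := by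
    ext1 x
    rw [← gradient_eq_smul_score (hf x) (hf0 x), gradient, LinearIsometryEquiv.apply_symm_apply]
  refine contDiff_one_iff_fderiv.mpr ⟨hf, ?_⟩
  rw [hfderiv]
  exact (InnerProductSpace.toDual ℝ _).continuous.comp (hf.continuous.smul hs)

end Density

section Flow

variable {Ω E F : Type*} [MeasurableSpace Ω] {P : Measure Ω} [IsFiniteMeasure P]
  [NormedAddCommGroup E] [NormedSpace ℝ E] [NormedAddCommGroup F] [NormedSpace ℝ F]

theorem exists_norm_fderiv_apply_le {X : Type*} [TopologicalSpace X] {S : Set X}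
    (hS : IsCompact S) {V : X → E → E} (hV : ContinuousOn (fun z : X × E => V z.1 z.2) (S ×ˢ univ))
    {f : E → F} (hf : ContDiff ℝ 1 f) (hfc : HasCompactSupport f) :
    ∃ C, ∀ t ∈ S, ∀ y, ‖fderiv ℝ f y (V t y)‖ ≤ C := by
  obtain ⟨C, hC⟩ := (hS.prod hfc).exists_bound_of_continuousOn
    (f := fun z : X × E => fderiv ℝ f z.2 (V z.1 z.2))
    (((hf.continuous_fderiv one_ne_zero).comp continuous_snd).continuousOn.clm_apply
      (hV.mono (prod_mono_right (subset_univ _))))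
  refine ⟨max C 0, fun t ht y => ?_⟩
  by_cases hy : y ∈ tsupport f
  · exact (hC (t, y) ⟨ht, hy⟩).trans (le_max_left _ _)
  · rw [image_eq_zero_of_notMem_tsupport fun hy' => hy (tsupport_fderiv_subset ℝ hy'),
      zero_apply, norm_zero]
    exact le_max_right _ _

theorem hasDerivAt_integral_comp_flow {φ : ℝ → Ω → E} {V : ℝ → E → E} {U : Set ℝ} {t : ℝ}
    (hU : U ∈ 𝓝 t) (hφm : ∀ r ∈ U, AEStronglyMeasurable (φ r) P)
    (hφ : ∀ x, ∀ r ∈ U, HasDerivAt (fun s => φ s x) (V r (φ r x)) r)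
    (hV : ContinuousOn (fun z : ℝ × E => V z.1 z.2) (U ×ˢ univ)) {f : E → F}
    (hf : ContDiff ℝ 1 f) (hfc : HasCompactSupport f) :
    HasDerivAt (fun s => ∫ x, f (φ s x) ∂P) (∫ x, fderiv ℝ f (φ t x) (V t (φ t x)) ∂P) t := by
  obtain ⟨S, hSt, hSU, hS⟩ := local_compact_nhds hU
  obtain ⟨C, hC⟩ := exists_norm_fderiv_apply_le hS (hV.mono (prod_mono_left hSU)) hf hfc
  obtain ⟨K, hK⟩ := hf.continuous.bounded_above_of_compact_support hfc
  have hmeas (r) (hr : r ∈ U) : AEStronglyMeasurable (fun x => f (φ r x)) P :=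
    hf.continuous.comp_aestronglyMeasurable (hφm r hr)
  have htU := mem_of_mem_nhds hU
  have hVt : Continuous (V t) := 
    hV.comp_continuous (f := fun y => (t, y)) (by fun_prop) fun _ => ⟨htU, trivial⟩
  have hderiv (x) (r) (hr : r ∈ S) :
      HasDerivAt (fun s => f (φ s x)) (fderiv ℝ f (φ r x) (V r (φ r x))) r :=
    (hf.differentiable one_ne_zero (φ r x)).hasFDerivAt.comp_hasDerivAt r (hφ x r (hSU hr))
  exact (hasDerivAt_integral_of_dominated_loc_of_deriv_le hSt
    (Filter.mem_of_superset hU hmeas) (.of_bound (hmeas t htU) K (.of_forall fun x => hK _))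
    (((hf.continuous_fderiv one_ne_zero).clm_apply hVt).comp_aestronglyMeasurable (hφm t htU))
    (.of_forall fun x r hr => hC r hr _) (integrable_const C) (.of_forall hderiv)).2

end Flow

theorem IsProbabilityDensity.integral_norm {m : ℕ} {f : EuclideanSpace ℝ (Fin m) → ℝ}
    (hf : IsProbabilityDensity f) : ∫ x, ‖f x‖ = 1 := by
  simpa only [Real.norm_of_nonneg (hf.1 _)] using hf.2.2

section ContinuousDAE

variable {m : ℕ} {T : ℝ} {P₀ : Measure (EuclideanSpace ℝ (Fin m))}
  {φ : ℝ → EuclideanSpace ℝ (Fin m) → EuclideanSpace ℝ (Fin m)}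
  {p q : ℝ → EuclideanSpace ℝ (Fin m) → ℝ} {t τ : ℝ}

theorem IsContinuousDAE.continuous_score (h : IsContinuousDAE T P₀ φ p) (ht : t ∈ Ico 0 T) :
    Continuous (score (p t)) :=
  h.continuousOn_score.comp_continuous (f := fun x => (t, x)) (by fun_prop) fun _ => ⟨ht, trivial⟩

theorem IsContinuousDAE.contDiff (h : IsContinuousDAE T P₀ φ p) (ht : t ∈ Ico 0 T) :
    ContDiff ℝ 1 (p t) :=
  contDiff_one_of_continuous_score (h.differentiable t ht) (fun x => (h.pos t ht x).ne')
    (h.continuous_score ht)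

theorem IsContinuousDAE.isDensityOf_zero (h : IsContinuousDAE T P₀ φ p) (hT : 0 < T) :
    IsDensityOf (p 0) P₀ := by
  simpa only [show φ 0 = id from funext h.initial, Measure.map_id] using
    h.pushforward 0 (left_mem_Ico.mpr hT)

theorem IsContinuousDAE.integral_comp {F : Type*} [NormedAddCommGroup F] [NormedSpace ℝ F]
    (h : IsContinuousDAE T P₀ φ p) (ht : t ∈ Ico 0 T) {f : EuclideanSpace ℝ (Fin m) → F}
    (hf : Continuous f) : ∫ x, f (φ t x) ∂P₀ = ∫ x, p t x • f x := by
  rw [← integral_map (h.measurable t ht).aemeasurable hf.aestronglyMeasurable,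
    (h.pushforward t ht).integral_eq (h.contDiff ht).continuous.aemeasurable]

theorem IsContinuousDAE.hasDerivAt_integral_smul [IsFiniteMeasure P₀]
    (h : IsContinuousDAE T P₀ φ p) (ht : t ∈ Ioo 0 T) {f : EuclideanSpace ℝ (Fin m) → ℂ}
    (hf : ContDiff ℝ 2 f) (hfc : HasCompactSupport f) :
    HasDerivAt (fun s => ∫ x, p s x • f x) (-∫ x, p t x • Δ f x) t := by
  have hU : Ioo 0 T ∈ 𝓝 t := Ioo_mem_nhds ht.1 ht.2
  have hsub : Ioo 0 T ⊆ Ico 0 T := Ioo_subset_Ico_self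
  have htr : ∫ x, fderiv ℝ f (φ t x) (score (p t) (φ t x)) ∂P₀ = -∫ x, p t x • Δ f x := by
    rw [h.integral_comp (hsub ht) (f := fun x => fderiv ℝ f x (score (p t) x))
      ((hf.continuous_fderiv two_ne_zero).clm_apply (h.continuous_score (hsub ht))),
      integral_smul_laplacian_eq_neg_integral_fderiv_gradient (h.contDiff (hsub ht)) hf hfc,
      neg_neg]
    simp only [gradient_eq_smul_score (h.differentiable t (hsub ht) _)
      (h.pos t (hsub ht) _).ne', map_smul]
  rw [← htr]
  exact (hasDerivAt_integral_comp_flow hU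
    (fun r hr => (h.measurable r (hsub hr)).aestronglyMeasurable)
    (fun x r hr => (h.flow x r (hsub hr)).hasDerivAt (Ico_mem_nhds hr.1 hr.2))
    (h.continuousOn_score.mono (prod_mono_left hsub)) (hf.of_le one_le_two)
    hfc).congr_of_eventuallyEq
    (Filter.mem_of_superset hU fun r hr => (h.integral_comp (hsub hr) hf.continuous).symm)

theorem IsContinuousDAE.isWeakSolution [IsFiniteMeasure P₀] (h : IsContinuousDAE T P₀ φ p)
    (hτ : τ < T) : IsWeakSolution (-1) 0 τ p := by
  have hI (t) (ht : t ∈ Icc 0 τ) : t ∈ Ico 0 T := ⟨ht.1, ht.2.trans_lt hτ⟩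
  have hp (t) (ht : t ∈ Icc 0 τ) : AEMeasurable (p t) :=
    (h.contDiff (hI t ht)).continuous.aemeasurable
  refine ⟨fun t ht => (h.pushforward t (hI t ht)).integrable (hp t ht),
    ⟨P₀.real univ, fun t ht => ?_⟩, fun f hf hfc => ?_, fun f hf hfc t ht => ?_⟩
  · rw [(h.pushforward t (hI t ht)).integral_norm (hp t ht),
      map_measureReal_apply (h.measurable t (hI t ht)) MeasurableSet.univ, preimage_univ]
  · obtain ⟨C, hC⟩ := hf.continuous.bounded_above_of_compact_support hfc
    refine ContinuousOn.congr ?_ fun t ht => (h.integral_comp (hI t ht) hf.continuous).symm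
    refine continuousOn_of_dominated (bound := fun _ => C)
      (fun t ht => hf.continuous.aestronglyMeasurable.comp_measurable (h.measurable t (hI t ht)))
      (fun t _ => .of_forall fun x => hC _) (integrable_const C) (.of_forall fun x => ?_)
    exact hf.continuous.comp_continuousOn fun t ht =>
      (h.flow x t (hI t ht)).continuousWithinAt.mono hI
  · rw [neg_one_smul]
    exact h.hasDerivAt_integral_smul ⟨ht.1, ht.2.trans hτ⟩ hf hfc

theorem IsContinuousDAE.solvesBackwardHeat [IsFiniteMeasure P₀] (h : IsContinuousDAE T P₀ φ p) :
    SolvesBackwardHeat (Ico 0 T) p := by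
  refine solvesDiffusion_of_forall_nhdsWithin fun t ht => ?_
  obtain ⟨σ, htσ, hσT⟩ := exists_between ht.2
  refine ⟨Ico 0 σ, ?_, (h.isWeakSolution hσT).solvesBackwardHeat fun r hr =>
    (h.contDiff ⟨hr.1, hr.2.trans hσT⟩).continuous⟩
  filter_upwards [self_mem_nhdsWithin, mem_nhdsWithin_of_mem_nhds (Iio_mem_nhds htσ)] with r hr hrσ
  exact ⟨hr.1, hrσ⟩

theorem IsContinuousDAE.eq_of_solvesBackwardHeat [IsFiniteMeasure P₀]
    (h : IsContinuousDAE T P₀ φ p) (hτ : τ < T) (hq : SolvesBackwardHeat (Icc 0 τ) q)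
    (hq0 : IsDensityOf (q 0) P₀) (hint : ∀ t ∈ Icc 0 τ, Integrable (q t))
    (hbdd : ∃ M, ∀ t ∈ Icc 0 τ, ∫ x, ‖q t x‖ ≤ M) (ht : t ∈ Icc 0 τ) : p t = q t := by
  have hT : 0 < T := (ht.1.trans ht.2).trans_lt hτ
  have htT : t ∈ Ico 0 T := ⟨ht.1, ht.2.trans_lt hτ⟩
  have hinit : p 0 = q 0 := (h.isDensityOf_zero hT).eq_of_continuous hq0
    (h.contDiff (left_mem_Ico.mpr hT)).continuous
    (hq.contDiff 0 ⟨le_rfl, ht.1.trans ht.2⟩).continuous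
  exact ((h.isWeakSolution hτ).mono le_rfl ht.2).eq_of_eq
    ((SolvesDiffusion.isWeakSolution hq hint hbdd).mono le_rfl ht.2) ht.1
    (h.contDiff htT).continuous (hq.contDiff t ht).continuous hinit

theorem IsContinuousDAE.solvesHeat_and_isDensityOf_iff [IsFiniteMeasure P₀]
    (h : IsContinuousDAE T P₀ φ p) (hτ : τ ∈ Ioo 0 T) {u : ℝ → EuclideanSpace ℝ (Fin m) → ℝ}
    (hint : ∀ t ∈ Icc 0 τ, Integrable (u t)) (hbdd : ∃ M, ∀ t ∈ Icc 0 τ, ∫ x, ‖u t x‖ ≤ M) :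
    (SolvesHeat (Icc 0 τ) u ∧ IsDensityOf (u τ) P₀) ↔ ∀ t ∈ Icc 0 τ, p t = u (τ - t) := by
  have hI : MapsTo (fun t => τ - t) (Icc 0 τ) (Icc 0 τ) := fun _ =>
    sub_mem_Icc_zero_iff_right.mpr
  have hrev : SolvesHeat (Icc 0 τ) u ↔ SolvesBackwardHeat (Icc 0 τ) fun t => u (τ - t) := by
    simp only [solvesBackwardHeat_iff_solvesHeat_const_sub hI, sub_sub_cancel]
  rw [hrev]
  refine ⟨fun hu t ht => ?_, fun hpu => ⟨?_, ?_⟩⟩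
  · exact h.eq_of_solvesBackwardHeat hτ.2 hu.1 (by simpa only [sub_zero] using hu.2)
      (fun t ht => hint _ (hI ht)) (hbdd.imp fun M hM t ht => hM _ (hI ht)) ht
  · exact (SolvesDiffusion.mono h.solvesBackwardHeat fun t ht => ⟨ht.1, ht.2.trans_lt hτ.2⟩).congr
      fun t ht => (hpu t ht).symm
  · have hp0 := hpu 0 (left_mem_Icc.mpr hτ.1.le)
    rw [sub_zero] at hp0
    exact hp0 ▸ h.isDensityOf_zero (hτ.1.trans hτ.2)

end ContinuousDAE

theorem theorem2_general (m : ℕ) (T : ℝ) (hT : 0 < T)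
    (P₀ : Measure (EuclideanSpace ℝ (Fin m))) [IsFiniteMeasure P₀]
    (φ : ℝ → EuclideanSpace ℝ (Fin m) → EuclideanSpace ℝ (Fin m))
    (p : ℝ → EuclideanSpace ℝ (Fin m) → ℝ)
    (hφ : IsContinuousDAE T P₀ φ p) :
    (SolvesBackwardHeat (Ico 0 T) p ∧ IsDensityOf (p 0) P₀) ∧
    ∀ τ ∈ Ioo 0 T,
      (∀ q : ℝ → EuclideanSpace ℝ (Fin m) → ℝ,
        (SolvesBackwardHeat (Icc 0 τ) q ∧ IsDensityOf (q 0) P₀) ↔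
          (SolvesHeat (Icc 0 τ) (fun t => q (τ - t)) ∧
            IsDensityOf (q (τ - τ)) P₀)) ∧
      (∀ u : ℝ → EuclideanSpace ℝ (Fin m) → ℝ,
        (∀ t ∈ Icc 0 τ, Integrable (u t)) → (∃ M, ∀ t ∈ Icc 0 τ, ∫ x, ‖u t x‖ ≤ M) →
          ((SolvesHeat (Icc 0 τ) u ∧ IsDensityOf (u τ) P₀) ↔
            ∀ t ∈ Icc 0 τ, p t = u (τ - t))) := by
  refine ⟨⟨hφ.solvesBackwardHeat, hφ.isDensityOf_zero hT⟩, fun τ hτ => ⟨fun q => ?_, ?_⟩⟩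
  · rw [sub_self, solvesBackwardHeat_iff_solvesHeat_const_sub fun _ =>
      sub_mem_Icc_zero_iff_right.mpr]
  · exact fun u hint hbdd => hφ.solvesHeat_and_isDensityOf_iff hτ hint hbdd

theorem theorem2 (m : ℕ) (T : ℝ) (hT : 0 < T)
    (P₀ : Measure (EuclideanSpace ℝ (Fin m))) [IsProbabilityMeasure P₀]
    (φ : ℝ → EuclideanSpace ℝ (Fin m) → EuclideanSpace ℝ (Fin m))
    (p : ℝ → EuclideanSpace ℝ (Fin m) → ℝ)
    (hφ : IsContinuousDAE T P₀ φ p) :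
    -- the backward heat equation, with initial value the data distribution
    (SolvesBackwardHeat (Ico 0 T) p ∧ IsDensityOf (p 0) P₀) ∧
    ∀ τ ∈ Ioo 0 T,
      -- the initial value problem for the backward heat equation is equivalent to the final value
      -- problem for the heat equation by reversing time
      (∀ q : ℝ → EuclideanSpace ℝ (Fin m) → ℝ,
        (SolvesBackwardHeat (Icc 0 τ) q ∧ IsDensityOf (q 0) P₀) ↔
          (SolvesHeat (Icc 0 τ) (fun t => q (τ - t)) ∧
            IsDensityOf (q (τ - τ)) P₀)) ∧
      -- among families of probability densities, the final value problem characterizes `p`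
      (∀ u : ℝ → EuclideanSpace ℝ (Fin m) → ℝ,
        (∀ t ∈ Icc 0 τ, IsProbabilityDensity (u t)) →
          ((SolvesHeat (Icc 0 τ) u ∧ IsDensityOf (u τ) P₀) ↔
            ∀ t ∈ Icc 0 τ, p t = u (τ - t))) :=
  (theorem2_general m T hT P₀ φ p hφ).imp_right fun h τ hτ => (h τ hτ).imp_right
    fun h u hu => h u (fun t ht => (hu t ht).2.1) ⟨1, fun t ht => (hu t ht).integral_norm.le⟩
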